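/- For a positive integer $n$, let $S_n$ be the finite set of all symmetric $n\times n$ real matrices with zero diagonal and off-diagonal entries in $\{-1,1\}$. Given a real number $c>0$, let $A$ be uniformly distributed on $S_n$, put $B=I_n+\frac{c}{\sqrt n}A$, and define a random $n\times n$ real matrix $C$ as follows: if $B$ is positive semidefinite, $C$ is a Cholesky factor of $B$, i.e. an upper triangular matrix with nonnegative diagonal entries such that $C^TC=B$ (it is unique when $B$ is positive definite; when $B$ is singular, a factor is chosen arbitrarily as a function of $B$); if $B$ is not positive semidefinite, $C=0$. A matrix $\Phi$ with $N$ columns satisfies the Restricted Isometry Property (RIP) of order $k$ with parameter $\delta$ if $(1-\delta)\|x\|^2\le\|\Phi x\|^2\le(1+\delta)\|x\|^2$ (Euclidean norms) for every $x\in\mathbb C^N$ with at most $k$ nonzero coordinates. There is an absolute constant $k_0\in\mathbb N$ such that for all integers $n\ge k\ge k_0$ and all real numbers $c>0$ and $\delta$ with $$3c<\min\left(1,\ \frac{\delta\sqrt n}{\sqrt k}\right),$$ the matrix $C$ satisfies the RIP of order $k$ with parameter $\delta$ with probability at least $$1-4\exp\left[k\ln\frac{ne}{k}-\frac{1}{32}\left(\frac{\delta\sqrt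 n}{c}-3\sqrt k\right)^2\right]-4\exp\left[-\frac{1}{32}\left(\frac1c-3\right)^2n\right].$$ -/

import Mathlib

/-- The set of all symmetric `n × n` real matrices with zero diagonal and off-diagonal
entries in `{-1, 1}`. -/
def signMatrices (n : ℕ) : Set (Matrix (Fin n) (Fin n) ℝ) :=
  {A | A.IsSymm ∧ (∀ i, A i i = 0) ∧ ∀ i j, i ≠ j → A i j = 1 ∨ A i j = -1}

/-- The matrix `I + c A / √n`. -/
noncomputable def shiftedMatrix {n : ℕ} (c : ℝ) (A : Matrix (Fin n) (Fin n) ℝ) :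
    Matrix (Fin n) (Fin n) ℝ :=
  1 + (c / √(n : ℝ)) • A

/-- `C` is a Cholesky factor of `B`: it is upper triangular, its diagonal entries are
nonnegative, and `Cᵀ C = B`. -/
def IsCholeskyFactor {n : ℕ} (B C : Matrix (Fin n) (Fin n) ℝ) : Prop :=
  (∀ i j, j < i → C i j = 0) ∧ (∀ i, 0 ≤ C i i) ∧ C.transpose * C = B

open scoped MatrixOrder in
theorem exists_isCholeskyFactor {n : ℕ} {B : Matrix (Fin n) (Fin n) ℝ} (hB : B.PosSemidef) :
    ∃ C, IsCholeskyFactor B C := by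
  obtain ⟨D, hD⟩ := CStarAlgebra.nonneg_iff_eq_star_mul_self.mp hB.nonneg
  have hcard : Module.finrank ℝ (EuclideanSpace ℝ (Fin n)) = Fintype.card (Fin n) := by simp
  let f : Fin n → EuclideanSpace ℝ (Fin n) := fun j => WithLp.toLp 2 (fun i => D i j)
  let b := InnerProductSpace.gramSchmidtOrthonormalBasis hcard f
  refine ⟨Matrix.of fun i j => inner ℝ (b i) (f j), ?_, ?_, ?_⟩
  · intro i j hij
    exact InnerProductSpace.gramSchmidtOrthonormalBasis_inv_triangular hcard f hij
  · intro i
    simp only [Matrix.of_apply, b]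
    by_cases hi : InnerProductSpace.gramSchmidtNormed ℝ f i = 0
    · rw [InnerProductSpace.inner_gramSchmidtOrthonormalBasis_eq_zero hcard hi]
    · rw [InnerProductSpace.gramSchmidtOrthonormalBasis_apply hcard hi,
        InnerProductSpace.gramSchmidtNormed, inner_smul_left]
      refine mul_nonneg (by simp) ?_
      have hf := congrArg (fun v => inner ℝ (InnerProductSpace.gramSchmidt ℝ f i) v)
        (InnerProductSpace.gramSchmidt_def'' ℝ f i)
      simp only [inner_add_right, inner_sum, inner_smul_right] at hf
      rw [hf, Finset.sum_eq_zero, add_zero]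
      · exact real_inner_self_nonneg
      · intro l hl
        rw [InnerProductSpace.gramSchmidt_orthogonal ℝ f (Finset.mem_Iio.mp hl).ne', mul_zero]
  · ext i j
    have h := b.sum_inner_mul_inner (f i) (f j)
    rw [hD]
    simp only [Matrix.mul_apply, Matrix.transpose_apply, Matrix.of_apply]
    rw [Finset.sum_congr rfl fun l _ => by rw [real_inner_comm (f i) (b l)], h]
    simp [f, PiLp.inner_apply, Matrix.star_apply, mul_comm]

open Classical in
/-- The Cholesky factor of `B` if `B` is positive semidefinite, and `0` otherwise.
(The factor is unique when `B` is positive definite; if `B` is singular some factor is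
chosen.) -/
noncomputable def choleskyOrZero {n : ℕ} (B : Matrix (Fin n) (Fin n) ℝ) :
    Matrix (Fin n) (Fin n) ℝ :=
  if hB : B.PosSemidef then (exists_isCholeskyFactor hB).choose else 0

/-- The probability that a uniformly random element of the finite set `S` lies in `E`. -/
noncomputable def uniformProb {α : Type*} (S E : Set α) : ℝ :=
  ((S ∩ E).ncard : ℝ) / (S.ncard : ℝ)

/-- A vector is `k`-sparse if it has at most `k` nonzero coordinates. -/
def IsSparse {N : ℕ} (k : ℕ) (x : EuclideanSpace ℂ (Fin N)) : Prop :=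
  {i | x i ≠ 0}.ncard ≤ k

/-- The restricted isometry property of order `k` with parameter `δ`:
`(1 - δ) ‖x‖² ≤ ‖Φ x‖² ≤ (1 + δ) ‖x‖²` for all `k`-sparse complex vectors `x`
(Euclidean norms). -/
def SatisfiesRIP {m N : ℕ} (k : ℕ) (δ : ℝ) (Φ : Matrix (Fin m) (Fin N) ℂ) : Prop :=
  ∀ x : EuclideanSpace ℂ (Fin N), IsSparse k x →
    (1 - δ) * ‖x‖ ^ 2 ≤ ‖Matrix.toEuclideanLin Φ x‖ ^ 2 ∧
      ‖Matrix.toEuclideanLin Φ x‖ ^ 2 ≤ (1 + δ) * ‖x‖ ^ 2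

/-! Since `Cᵀ * C = I + (c/√n) A`, the RIP only asks that the quadratic form of `A` be at most
`δ√n/c` times the squared norm, in absolute value, on vectors supported on each `k`-set `T`.
Positive semidefiniteness asks for the lower bound `-√n/c` on all vectors. Both follow from one tail
bound for the largest eigenvalue of an `m × m` principal submatrix, `m ≥ 100`
(`ncard_quadFormExceeds_le`), applied to `A` and `-A`, with a union bound over `T`.

The tail bound replaces a net on the sphere by an average over the unit ball. For fixed `y` in the
ball the form is a sum of independent signs, so its exponential moment at `θ` is at most `exp(θ²)`
(`sum_exp_quadForm_le`). Conversely, an eigenvalue `lam > s` with unit eigenvector `v` makes the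
form large on a half ball of radius 3/5 about `(4/5)v`. By Jensen the ball average of `exp(θ ·
form)` is then at least about `(3/5)^m exp(0.54 θ s)` (`le_integral_ball_exp_quadForm`). Markov's
inequality and optimising `θ` finish. -/

open MeasureTheory

/-! ### Sign matrices as families of independent signs -/

/-- The quadratic form `∑ i j, x i * M i j * x j` of a matrix `M`. -/
noncomputable def quadForm {n : ℕ} (M : Matrix (Fin n) (Fin n) ℝ) (x : Fin n → ℝ) : ℝ :=
  ∑ i, ∑ j, x i * M i j * x j

/-- The positions strictly above the diagonal. -/
abbrev UpperIndex (n : ℕ) : Type := {p : Fin n × Fin n // p.1 < p.2}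

theorem sum_sum_eq_diag_add_upper {n : ℕ} (g : Fin n → Fin n → ℝ) (hg : ∀ i j, g i j = g j i) :
    ∑ i, ∑ j, g i j = ∑ i, g i i + 2 * ∑ p : UpperIndex n, g p.1.1 p.1.2 := by
  have h1 : ∀ i, ∑ j, g i j = g i i + (∑ j, if i < j then g i j else 0)
      + ∑ j, if j < i then g i j else 0 := by
    intro i
    have : g i i = ∑ j, if j = i then g i j else 0 := by simp
    rw [this, ← Finset.sum_add_distrib, ← Finset.sum_add_distrib]
    refine Finset.sum_congr rfl fun j _ => ?_
    rcases lt_trichotomy i j with h | h | h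
    · simp [h, h.ne', h.not_gt]
    · simp [h]
    · simp [h, h.ne, h.not_gt]
  have h2 : ∑ i, ∑ j, (if j < i then g i j else 0) = ∑ i, ∑ j, if i < j then g i j else 0 := by
    rw [Finset.sum_comm]
    refine Finset.sum_congr rfl fun i _ => Finset.sum_congr rfl fun j _ => ?_
    rw [hg]
  have h3 : ∑ p : UpperIndex n, g p.1.1 p.1.2 = ∑ i, ∑ j, if i < j then g i j else 0 := by
    rw [← Fintype.sum_prod_type' (fun i j => if i < j then g i j else 0), ← Finset.sum_filter]
    exact (Finset.sum_subtype (Finset.univ.filter fun p : Fin n × Fin n => p.1 < p.2)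
      (by simp) (fun p => g p.1 p.2)).symm
  rw [Finset.sum_congr rfl fun i _ => h1 i, Finset.sum_add_distrib, Finset.sum_add_distrib, h2, h3]
  ring

/-- The real number `1` or `-1` encoded by a Boolean. -/
def boolSign (b : Bool) : ℝ := if b then 1 else -1

theorem boolSign_injective : Function.Injective boolSign := by
  intro a b
  cases a <;> cases b <;> simp [boolSign] <;> norm_num

/-- The symmetric sign matrix with prescribed entries above the diagonal. -/
noncomputable def signMatrixOf {n : ℕ} (f : UpperIndex n → Bool) : Matrix (Fin n) (Fin n) ℝ :=
  Matrix.of fun i j => if h : i < j then boolSign (f ⟨(i, j), h⟩)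
    else if h : j < i then boolSign (f ⟨(j, i), h⟩) else 0

theorem signMatrixOf_upper {n : ℕ} (f : UpperIndex n → Bool) (p : UpperIndex n) :
    signMatrixOf f p.1.1 p.1.2 = boolSign (f p) := by
  simp [signMatrixOf, p.2]

theorem signMatrixOf_injective {n : ℕ} : Function.Injective (signMatrixOf (n := n)) := by
  intro f g h
  funext p
  apply boolSign_injective
  rw [← signMatrixOf_upper, ← signMatrixOf_upper, h]

/-- With injectivity, this turns counting sign matrices into counting independent bits. -/
theorem range_signMatrixOf (n : ℕ) : Set.range (signMatrixOf (n := n)) = signMatrices n := by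
  ext A
  constructor
  · rintro ⟨f, rfl⟩
    refine ⟨?_, fun i => by simp [signMatrixOf], fun i j hij => ?_⟩
    · ext i j
      rcases lt_trichotomy i j with h | h | h
      · simp [signMatrixOf, h, h.not_gt]
      · simp [h]
      · simp [signMatrixOf, h, h.not_gt]
    · have hb : ∀ b, boolSign b = 1 ∨ boolSign b = -1 := by
        intro b; cases b <;> simp [boolSign]
      rcases lt_or_gt_of_ne hij with h | h
      · simpa [signMatrixOf, h] using hb _
      · simpa [signMatrixOf, h, h.not_gt] using hb _
  · rintro ⟨hs, hd, ho⟩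
    classical
    refine ⟨fun p => decide (A p.1.1 p.1.2 = 1), ?_⟩
    have key : ∀ i j, i ≠ j → boolSign (decide (A i j = 1)) = A i j := by
      intro i j hij
      rcases ho i j hij with h | h
      · simp [h, boolSign]
      · rw [h]; norm_num [boolSign]
    ext i j
    rcases lt_trichotomy i j with h | h | h
    · simp [signMatrixOf, h, key i j h.ne]
    · subst h; simp [signMatrixOf, hd]
    · simp [signMatrixOf, h, h.not_gt, hs.apply i j, key i j h.ne']

theorem finite_signMatrices (n : ℕ) : (signMatrices n).Finite := by
  rw [← range_signMatrixOf]; exact Set.finite_range _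

theorem quadForm_signMatrixOf {n : ℕ} (f : UpperIndex n → Bool) (x : Fin n → ℝ) :
    quadForm (signMatrixOf f) x = ∑ p : UpperIndex n, 2 * (x p.1.1 * x p.1.2) * boolSign (f p) := by
  have hA : signMatrixOf f ∈ signMatrices n := range_signMatrixOf n ▸ ⟨f, rfl⟩
  rw [quadForm, sum_sum_eq_diag_add_upper _ fun i j => by rw [hA.1.apply j i]; ring]
  simp only [hA.2.1, mul_zero, zero_mul, Finset.sum_const_zero, zero_add, Finset.mul_sum,
    signMatrixOf_upper]
  exact Finset.sum_congr rfl fun p _ => by ring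

/-! ### Exponential moments of the quadratic form -/

/-- Dropping the diagonal terms of the squared norm's square bounds the variance of the random form
by twice that square. -/
theorem two_mul_sum_upper_sq_le {n : ℕ} (x : Fin n → ℝ) :
    2 * ∑ p : UpperIndex n, (x p.1.1 * x p.1.2) ^ 2 ≤ (∑ i, x i ^ 2) ^ 2 := by
  have h : (∑ i, x i ^ 2) ^ 2 = ∑ i, ∑ j, (x i * x j) ^ 2 := by
    rw [sq, Finset.sum_mul_sum]
    simp only [mul_pow]
  rw [h, sum_sum_eq_diag_add_upper _ fun i j => by ring]
  have : 0 ≤ ∑ i, (x i * x i) ^ 2 := Finset.sum_nonneg fun i _ => sq_nonneg _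
  linarith

/-- The quadratic form of a uniformly random sign matrix is sub-Gaussian. -/
theorem sum_exp_quadForm_le {n : ℕ} (θ : ℝ) (x : Fin n → ℝ) :
    ∑ f : UpperIndex n → Bool, Real.exp (θ * quadForm (signMatrixOf f) x) ≤
      Fintype.card (UpperIndex n → Bool) * Real.exp (θ ^ 2 * (∑ i, x i ^ 2) ^ 2) := by
  have h1 : ∀ f : UpperIndex n → Bool, Real.exp (θ * quadForm (signMatrixOf f) x) =
      ∏ p : UpperIndex n, Real.exp (θ * (2 * (x p.1.1 * x p.1.2)) * boolSign (f p)) := by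
    intro f
    rw [quadForm_signMatrixOf, ← Real.exp_sum, Finset.mul_sum]
    exact congrArg _ (Finset.sum_congr rfl fun p _ => by ring)
  -- Independence: the sum over all sign choices of a product factors over the positions.
  have h2 := (Finset.prod_univ_sum (fun _ : UpperIndex n => (Finset.univ : Finset Bool))
    (fun p b => Real.exp (θ * (2 * (x p.1.1 * x p.1.2)) * boolSign b)))
  rw [Fintype.piFinset_univ] at h2
  rw [Finset.sum_congr rfl fun f _ => h1 f, ← h2]
  have h3 : ∀ p : UpperIndex n,
      ∑ b : Bool, Real.exp (θ * (2 * (x p.1.1 * x p.1.2)) * boolSign b) ≤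
        2 * Real.exp (2 * θ ^ 2 * (x p.1.1 * x p.1.2) ^ 2) := by
    intro p
    have h := Real.cosh_le_exp_half_sq (θ * (2 * (x p.1.1 * x p.1.2)))
    rw [Real.cosh_eq] at h
    rw [show 2 * θ ^ 2 * (x p.1.1 * x p.1.2) ^ 2 = (θ * (2 * (x p.1.1 * x p.1.2))) ^ 2 / 2 by ring]
    simp only [Fintype.sum_bool, boolSign, if_true, Bool.false_eq_true, if_false, mul_one,
      mul_neg]
    linarith
  refine (Finset.prod_le_prod (fun p _ => Finset.sum_nonneg fun b _ => (Real.exp_pos _).le)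
    fun p _ => h3 p).trans ?_
  rw [Finset.prod_mul_distrib, Finset.prod_const, ← Real.exp_sum, Fintype.card_fun,
    Fintype.card_bool, ← Finset.card_univ, ← Finset.mul_sum]
  push_cast
  refine mul_le_mul_of_nonneg_left (Real.exp_le_exp.mpr ?_) (by positivity)
  have := mul_le_mul_of_nonneg_left (two_mul_sum_upper_sq_le x) (sq_nonneg θ)
  linarith

/-! ### Moments of the uniform measure on the unit ball -/

theorem integral_ball_comp_linearIsometryEquiv {m : ℕ}
    (L : EuclideanSpace ℝ (Fin m) ≃ₗᵢ[ℝ] EuclideanSpace ℝ (Fin m))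
    (g : EuclideanSpace ℝ (Fin m) → ℝ) :
    ∫ y in Metric.ball 0 1, g (L y) = ∫ y in Metric.ball 0 1, g y := by
  have h := L.measurePreserving.setIntegral_preimage_emb
    L.toHomeomorph.measurableEmbedding g (Metric.ball 0 1)
  rw [← h]
  congr 2
  ext y
  simp

theorem integrableOn_ball_of_continuous {m : ℕ} {g : EuclideanSpace ℝ (Fin m) → ℝ}
    (hg : Continuous g) : IntegrableOn g (Metric.ball 0 1) :=
  (hg.continuousOn.integrableOn_compact (isCompact_closedBall 0 1)).mono_set
    Metric.ball_subset_closedBall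

/-- Flipping the sign of coordinate `i` preserves the ball and negates the integrand. -/
theorem integral_ball_mul_of_ne {m : ℕ} {i j : Fin m} (hij : i ≠ j) :
    ∫ y : EuclideanSpace ℝ (Fin m) in Metric.ball 0 1, y i * y j = 0 := by
  let L := LinearIsometryEquiv.piLpCongrRight 2 (fun l : Fin m =>
    if l = i then LinearIsometryEquiv.neg ℝ (E := ℝ) else LinearIsometryEquiv.refl ℝ ℝ)
  have h := integral_ball_comp_linearIsometryEquiv L (fun y => y i * y j)
  have h2 : ∀ y : EuclideanSpace ℝ (Fin m), (L y) i * (L y) j = -(y i * y j) := by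
    intro y
    simp [L, hij.symm]
  simp only [h2, integral_neg] at h
  linarith

/-- Coordinate swaps make all second moments equal, and their sum is at most the volume because `‖y‖
≤ 1`. -/
theorem integral_ball_sq_le {m : ℕ} (i : Fin m) :
    ∫ y : EuclideanSpace ℝ (Fin m) in Metric.ball 0 1, y i ^ 2 ≤
      volume.real (Metric.ball (0 : EuclideanSpace ℝ (Fin m)) 1) / m := by
  have hm : (0 : ℝ) < m := by exact_mod_cast i.pos
  have heq : ∀ j : Fin m, ∫ y : EuclideanSpace ℝ (Fin m) in Metric.ball 0 1, y j ^ 2 =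
      ∫ y : EuclideanSpace ℝ (Fin m) in Metric.ball 0 1, y i ^ 2 := by
    intro j
    have h := integral_ball_comp_linearIsometryEquiv
      (LinearIsometryEquiv.piLpCongrLeft 2 ℝ ℝ (Equiv.swap i j)) (fun y => y i ^ 2)
    rw [← h]
    simp [LinearIsometryEquiv.piLpCongrLeft_apply, Equiv.piCongrLeft'_apply]
  have hsum : ∑ j : Fin m, ∫ y : EuclideanSpace ℝ (Fin m) in Metric.ball 0 1, y j ^ 2 ≤
      volume.real (Metric.ball (0 : EuclideanSpace ℝ (Fin m)) 1) := by
    rw [← integral_finsetSum _ fun j _ => integrableOn_ball_of_continuous (by fun_prop)]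
    have h1 : ∫ y : EuclideanSpace ℝ (Fin m) in Metric.ball 0 1, (1 : ℝ) =
        volume.real (Metric.ball (0 : EuclideanSpace ℝ (Fin m)) 1) := by simp
    rw [← h1]
    refine setIntegral_mono_on (integrableOn_ball_of_continuous (by fun_prop))
      (integrableOn_ball_of_continuous (by fun_prop)) measurableSet_ball fun y hy => ?_
    rw [← EuclideanSpace.real_norm_sq_eq]
    have : ‖y‖ < 1 := by simpa using hy
    nlinarith [norm_nonneg y]
  rw [Finset.sum_congr rfl fun j _ => heq j] at hsum
  simp only [Finset.sum_const, Finset.card_univ, Fintype.card_fin, nsmul_eq_mul] at hsum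
  rw [le_div_iff₀ hm]
  linarith

theorem continuous_quadForm {m : ℕ} (M : Matrix (Fin m) (Fin m) ℝ) :
    Continuous fun y : EuclideanSpace ℝ (Fin m) => quadForm M y := by
  unfold quadForm
  fun_prop

theorem quadForm_neg_right {m : ℕ} (M : Matrix (Fin m) (Fin m) ℝ) (y : Fin m → ℝ) :
    quadForm M (-y) = quadForm M y := by
  simp [quadForm]

theorem integral_ball_quadForm_eq_zero {m : ℕ} {M : Matrix (Fin m) (Fin m) ℝ}
    (hd : ∀ i, M i i = 0) :
    ∫ y : EuclideanSpace ℝ (Fin m) in Metric.ball 0 1, quadForm M y = 0 := by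
  unfold quadForm
  rw [integral_finsetSum _ fun j _ => integrableOn_ball_of_continuous (by fun_prop)]
  refine Finset.sum_eq_zero fun i _ => ?_
  rw [integral_finsetSum _ fun j _ => integrableOn_ball_of_continuous (by fun_prop)]
  refine Finset.sum_eq_zero fun j _ => ?_
  by_cases h : i = j
  · simp [h, hd]
  · have : ∀ y : EuclideanSpace ℝ (Fin m), y i * M i j * y j = M i j * (y i * y j) := by
      intro y; ring
    simp only [this, integral_const_mul, integral_ball_mul_of_ne h, mul_zero]

theorem integral_ball_inner_sq_le {m : ℕ} {v : EuclideanSpace ℝ (Fin m)} (hv : ‖v‖ = 1) :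
    ∫ y : EuclideanSpace ℝ (Fin m) in Metric.ball 0 1, (∑ i, v i * y i) ^ 2 ≤
      volume.real (Metric.ball (0 : EuclideanSpace ℝ (Fin m)) 1) / m := by
  have h1 : ∀ y : EuclideanSpace ℝ (Fin m), (∑ i, v i * y i) ^ 2 =
      ∑ i, ∑ j, v i * v j * (y i * y j) := by
    intro y
    rw [sq, Finset.sum_mul_sum]
    exact Finset.sum_congr rfl fun i _ => Finset.sum_congr rfl fun j _ => by ring
  simp only [h1]
  rw [integral_finsetSum _ fun j _ => integrableOn_ball_of_continuous (by fun_prop)]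
  have h2 : ∀ i, ∫ y : EuclideanSpace ℝ (Fin m) in Metric.ball 0 1,
      ∑ j, v i * v j * (y i * y j) = v i ^ 2 *
        ∫ y : EuclideanSpace ℝ (Fin m) in Metric.ball 0 1, y i ^ 2 := by
    intro i
    rw [integral_finsetSum _ fun j _ => integrableOn_ball_of_continuous (by fun_prop),
      Finset.sum_eq_single i]
    · rw [integral_const_mul, sq]
      simp only [sq]
    · intro j _ hj
      rw [integral_const_mul, integral_ball_mul_of_ne hj.symm, mul_zero]
    · simp
  rw [Finset.sum_congr rfl fun i _ => h2 i]
  calc _ ≤ ∑ i, v i ^ 2 *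
        (volume.real (Metric.ball (0 : EuclideanSpace ℝ (Fin m)) 1) / m) :=
        Finset.sum_le_sum fun i _ =>
          mul_le_mul_of_nonneg_left (integral_ball_sq_le i) (sq_nonneg _)
    _ = _ := by
        rw [← Finset.sum_mul, ← EuclideanSpace.real_norm_sq_eq, hv]
        ring

/-! ### Laplace-type lower bound near an eigenvector -/

theorem quadForm_add_smul_of_eigenvector {m : ℕ} {M : Matrix (Fin m) (Fin m) ℝ}
    (hM : M.IsSymm) {v : EuclideanSpace ℝ (Fin m)} (hv : ‖v‖ = 1) {lam : ℝ}
    (hlam : ∀ i, ∑ j, M i j * v j = lam * v i) (a b : ℝ) (y : EuclideanSpace ℝ (Fin m)) :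
    quadForm M (a • v + b • y : EuclideanSpace ℝ (Fin m)) =
      a ^ 2 * lam + 2 * a * b * lam * (∑ i, v i * y i) + b ^ 2 * quadForm M y := by
  have hvv : ∑ i, v i * v i = 1 := by
    have := EuclideanSpace.real_norm_sq_eq v
    rw [hv] at this
    simp only [← sq]
    linarith
  have e1 : ∑ i, ∑ j, v i * M i j * v j = lam := by
    have : ∀ i, ∑ j, v i * M i j * v j = lam * (v i * v i) := by
      intro i
      rw [← mul_left_comm, ← hlam, Finset.mul_sum]
      exact Finset.sum_congr rfl fun j _ => by ring
    rw [Finset.sum_congr rfl fun i _ => this i, ← Finset.mul_sum, hvv, mul_one]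
  have e2 : ∑ i, ∑ j, y i * M i j * v j = lam * ∑ i, v i * y i := by
    rw [Finset.mul_sum]
    refine Finset.sum_congr rfl fun i _ => ?_
    rw [← mul_assoc, ← hlam, Finset.sum_mul]
    exact Finset.sum_congr rfl fun j _ => by ring
  have e3 : ∑ i, ∑ j, v i * M i j * y j = lam * ∑ i, v i * y i := by
    rw [← e2, Finset.sum_comm]
    refine Finset.sum_congr rfl fun i _ => Finset.sum_congr rfl fun j _ => ?_
    rw [hM.apply i j]; ring
  have : quadForm M (a • v + b • y : EuclideanSpace ℝ (Fin m)) =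
      a ^ 2 * ∑ i, ∑ j, v i * M i j * v j + a * b * ∑ i, ∑ j, y i * M i j * v j +
      a * b * ∑ i, ∑ j, v i * M i j * y j + b ^ 2 * quadForm M y := by
    simp only [quadForm, Finset.mul_sum, ← Finset.sum_add_distrib]
    refine Finset.sum_congr rfl fun i _ => Finset.sum_congr rfl fun j _ => ?_
    simp only [PiLp.add_apply, PiLp.smul_apply, smul_eq_mul]
    ring
  rw [this, e1, e2, e3]
  ring

/-- Half of the ball integral of an even function is at most its integral over a half ball. -/
theorem integral_ball_le_two_mul_half {m : ℕ} {h : EuclideanSpace ℝ (Fin m) → ℝ}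
    (hc : Continuous h) (hpos : ∀ y, 0 ≤ h y) (heven : ∀ y, h (-y) = h y)
    (v : EuclideanSpace ℝ (Fin m)) :
    ∫ y in Metric.ball 0 1, h y ≤
      2 * ∫ y in Metric.ball 0 1 ∩ {y | ∑ i, v i * y i ≤ 0}, h y := by
  set H : Set (EuclideanSpace ℝ (Fin m)) := {y | ∑ i, v i * y i ≤ 0} with hH
  have hHm : MeasurableSet H := by
    apply IsClosed.measurableSet
    exact isClosed_le (by fun_prop) continuous_const
  have hint := integrableOn_ball_of_continuous hc
  have hsplit := integral_inter_add_sdiff (μ := volume) (s := Metric.ball 0 1) hHm hint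
  -- The reflection `y ↦ -y` carries the part of the ball outside `H` into the part inside `H`.
  have hneg : ∫ y in Metric.ball 0 1 \ H, h y ≤ ∫ y in Metric.ball 0 1 ∩ H, h y := by
    have h1 := (Measure.measurePreserving_neg
      (volume : Measure (EuclideanSpace ℝ (Fin m)))).setIntegral_preimage_emb
      (MeasurableEquiv.neg _).measurableEmbedding h (Metric.ball 0 1 ∩ H)
    rw [← h1]
    change _ ≤ ∫ y in (fun y => -y) ⁻¹' (Metric.ball 0 1 ∩ H), h (-y)
    simp only [heven]
    refine setIntegral_mono_set (hint.mono_set ?_) (Filter.Eventually.of_forall hpos) ?_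
    · intro y hy
      simpa using hy.1
    · refine LE.le.eventuallyLE fun y hy => ?_
      have h3 : 0 < ∑ i, v i * y i := by simpa [hH] using hy.2
      refine ⟨by simpa using hy.1, ?_⟩
      simp [hH, h3.le]
  linarith

/-- Laplace-type lower bound for the exponential moment of a quadratic form on the unit ball. -/
theorem le_integral_ball_exp_quadForm {m : ℕ} (hm : 0 < m) {M : Matrix (Fin m) (Fin m) ℝ}
    (hM : M.IsSymm) (hd : ∀ i, M i i = 0) {v : EuclideanSpace ℝ (Fin m)} (hv : ‖v‖ = 1)
    {lam : ℝ} (hlam0 : 0 ≤ lam) (hlam : ∀ i, ∑ j, M i j * v j = lam * v i)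
    {θ : ℝ} (hθ : 0 ≤ θ) :
    (3 / 5 : ℝ) ^ m / 2 * volume.real (Metric.ball (0 : EuclideanSpace ℝ (Fin m)) 1) *
        Real.exp (θ * (lam * (16 / 25 - 24 / 25 / √m))) ≤
      ∫ y : EuclideanSpace ℝ (Fin m) in Metric.ball 0 1, Real.exp (θ * quadForm M y) := by
  have hm' : (0 : ℝ) < m := by exact_mod_cast hm
  have hsq : 0 < √(m : ℝ) := Real.sqrt_pos.mpr hm'
  set V := volume.real (Metric.ball (0 : EuclideanSpace ℝ (Fin m)) 1) with hV
  have hV0 : 0 ≤ V := measureReal_nonneg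
  let w : EuclideanSpace ℝ (Fin m) → ℝ := fun y => ∑ i, v i * y i
  have hw : Continuous w := by fun_prop
  -- An even minorant of the form at `(4/5)v + (3/5)y`: the odd term `w y` is replaced by `-(√m/2 ·
  -- w² + 1/(2√m))`. Evenness allows passing from the half ball to the full ball, and the weights
  -- are balanced for `w²` of mean at most `1/m`.
  let q : EuclideanSpace ℝ (Fin m) → ℝ := fun y =>
    16 / 25 * lam - 24 / 25 * lam * (√m / 2 * w y ^ 2 + 1 / (2 * √m)) + 9 / 25 * quadForm M y
  have hqc : Continuous q := by
    have := continuous_quadForm M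
    fun_prop
  have hwneg : ∀ y, w (-y) = -w y := by intro y; simp [w]
  have hqe : ∀ y, q (-y) = q y := by
    intro y
    have : quadForm M (-y : EuclideanSpace ℝ (Fin m)) = quadForm M y :=
      quadForm_neg_right M y
    simp only [q, hwneg, this, neg_sq]
  let H : Set (EuclideanSpace ℝ (Fin m)) := {y | w y ≤ 0}
  -- As `(4/5)² + (3/5)² = 1`, the half of the unit ball where `w ≤ 0` is mapped into the unit ball.
  let φ : EuclideanSpace ℝ (Fin m) → EuclideanSpace ℝ (Fin m) :=
    fun y => (4 / 5 : ℝ) • v + (3 / 5 : ℝ) • y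
  let g : EuclideanSpace ℝ (Fin m) → ℝ :=
    (Metric.ball 0 1).indicator fun y => Real.exp (θ * quadForm M y)
  have hexpc : Continuous fun y : EuclideanSpace ℝ (Fin m) => Real.exp (θ * quadForm M y) := by
    have := continuous_quadForm M
    fun_prop
  have hgi : Integrable g := by
    rw [integrable_indicator_iff measurableSet_ball]
    exact integrableOn_ball_of_continuous hexpc
  have hg0 : ∀ y, 0 ≤ g y := fun y => Set.indicator_nonneg (fun _ _ => (Real.exp_pos _).le) y
  have hchange : ∫ y, g (φ y) = (5 / 3 : ℝ) ^ m * ∫ y, g y := by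
    have h1 := Measure.integral_comp_smul (volume : Measure (EuclideanSpace ℝ (Fin m)))
      (fun y => g ((4 / 5 : ℝ) • v + y)) (3 / 5 : ℝ)
    rw [integral_add_left_eq_self g, finrank_euclideanSpace_fin, smul_eq_mul, ← inv_pow, abs_pow,
      show |((3 / 5 : ℝ))⁻¹| = 5 / 3 by norm_num] at h1
    exact h1
  have hgφi : Integrable fun y => g (φ y) := by
    have h1 : Integrable fun y => g ((4 / 5 : ℝ) • v + y) := hgi.comp_add_left _
    exact h1.comp_smul (by norm_num : (3 / 5 : ℝ) ≠ 0)
  have hball : ∀ y ∈ Metric.ball (0 : EuclideanSpace ℝ (Fin m)) 1 ∩ H,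
      Real.exp (θ * q y) ≤ g (φ y) := by
    rintro y ⟨hy, hyH⟩
    have hyn : ‖y‖ < 1 := by simpa using hy
    have hyw : w y ≤ 0 := hyH
    have hin : φ y ∈ Metric.ball (0 : EuclideanSpace ℝ (Fin m)) 1 := by
      rw [mem_ball_zero_iff]
      have h1 := norm_add_sq_real ((4 / 5 : ℝ) • v) ((3 / 5 : ℝ) • y)
      have h2 : inner ℝ v y = w y := by
        simp [w, PiLp.inner_apply, mul_comm]
      rw [inner_smul_left, inner_smul_right, h2, norm_smul, norm_smul, hv] at h1
      norm_num at h1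
      have h3 : ‖φ y‖ ^ 2 < 1 := by
        simp only [φ]
        rw [h1]
        nlinarith [norm_nonneg y]
      nlinarith [norm_nonneg (φ y)]
    simp only [g, Set.indicator_of_mem hin, Real.exp_le_exp]
    refine mul_le_mul_of_nonneg_left ?_ hθ
    simp only [φ]
    rw [quadForm_add_smul_of_eigenvector hM hv hlam]
    have h4 : 0 ≤ √m / 2 * w y ^ 2 + 1 / (2 * √m) + w y := by
      have : √m / 2 * w y ^ 2 + 1 / (2 * √m) + w y = (√m * w y + 1) ^ 2 / (2 * √m) := by
        field_simp
        ring
      rw [this]; positivity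
    have h5 := mul_nonneg hlam0 h4
    simp only [q]
    change _ ≤ (4 / 5 : ℝ) ^ 2 * lam + 2 * (4 / 5) * (3 / 5) * lam * w y + _
    nlinarith
  have hHm : MeasurableSet H := (isClosed_le hw continuous_const).measurableSet
  have hexpq : Continuous fun y => Real.exp (θ * q y) := by fun_prop
  have hA : ∫ y in Metric.ball 0 1 ∩ H, Real.exp (θ * q y) ≤ ∫ y, g (φ y) := by
    refine (setIntegral_mono_on ((integrableOn_ball_of_continuous hexpq).mono_set
      Set.inter_subset_left) hgφi.integrableOn (measurableSet_ball.inter hHm) hball).trans ?_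
    exact setIntegral_le_integral hgφi (Filter.Eventually.of_forall fun y => hg0 _)
  have hB := integral_ball_le_two_mul_half hexpq (fun y => (Real.exp_pos _).le)
    (fun y => by rw [hqe]) v
  change _ ≤ 2 * ∫ y in Metric.ball 0 1 ∩ H, Real.exp (θ * q y) at hB
  set z : ℝ := θ * (lam * (16 / 25 - 24 / 25 / √m)) with hz
  -- Jensen's inequality, through the tangent line of `exp` at `z`, a lower bound for the mean of `θ
  -- * q`.
  have hC : V * Real.exp z ≤ ∫ y in Metric.ball 0 1, Real.exp (θ * q y) := by
    have hqi : ∫ y in Metric.ball 0 1, q y = (16 / 25 * lam - 24 / 25 * lam * (1 / (2 * √m))) * V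
        - 24 / 25 * lam * (√m / 2) * ∫ y in Metric.ball 0 1, w y ^ 2 := by
      have h1 : ∀ y, q y = (16 / 25 * lam - 24 / 25 * lam * (1 / (2 * √m)))
          - 24 / 25 * lam * (√m / 2) * w y ^ 2 + 9 / 25 * quadForm M y := by
        intro y; simp only [q]; ring
      simp only [h1]
      rw [integral_add, integral_sub, integral_const_mul, integral_const_mul,
        integral_ball_quadForm_eq_zero hd, setIntegral_const, smul_eq_mul, ← hV]
      · ring
      · exact integrableOn_ball_of_continuous (by fun_prop)
      · exact integrableOn_ball_of_continuous (by fun_prop)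
      · exact integrableOn_ball_of_continuous (by fun_prop)
      · exact integrableOn_ball_of_continuous ((continuous_quadForm M).const_mul _)
    have hqlow : V * (lam * (16 / 25 - 24 / 25 / √m)) ≤ ∫ y in Metric.ball 0 1, q y := by
      rw [hqi]
      have h2 := integral_ball_inner_sq_le hv
      rw [← hV] at h2
      have h3 : 24 / 25 * lam * (√m / 2) * ∫ y in Metric.ball 0 1, w y ^ 2 ≤
          24 / 25 * lam * (√m / 2) * (V / m) :=
        mul_le_mul_of_nonneg_left h2 (by positivity)
      have h4 : √m / 2 * (V / m) = V * (1 / (2 * √m)) := by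
        have : √(m : ℝ) * √m = m := Real.mul_self_sqrt hm'.le
        field_simp
        linear_combination V * this
      have h5 : 24 / 25 * lam * (√m / 2) * (V / m) = 24 / 25 * lam * (V * (1 / (2 * √m))) := by
        rw [← h4]; ring
      have h6 : (24 / 25 / √m : ℝ) = 24 / 25 * (1 / (2 * √m)) + 24 / 25 * (1 / (2 * √m)) := by
        field_simp
        norm_num
      rw [h6]
      linarith
    have hlow : ∫ y in Metric.ball 0 1, Real.exp z * (1 - z + θ * q y) ≤
        ∫ y in Metric.ball 0 1, Real.exp (θ * q y) := by
      refine setIntegral_mono_on (integrableOn_ball_of_continuous (by fun_prop))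
        (integrableOn_ball_of_continuous hexpq) measurableSet_ball fun y _ => ?_
      have h1 := Real.add_one_le_exp (θ * q y - z)
      calc _ ≤ Real.exp z * Real.exp (θ * q y - z) :=
            mul_le_mul_of_nonneg_left (by linarith) (Real.exp_pos _).le
        _ = _ := by rw [← Real.exp_add]; ring_nf
    refine le_trans ?_ hlow
    rw [integral_const_mul, integral_add (integrableOn_ball_of_continuous continuous_const)
      (integrableOn_ball_of_continuous (by fun_prop)), integral_const_mul, setIntegral_const,
      smul_eq_mul, ← hV, mul_comm V]
    refine mul_le_mul_of_nonneg_left ?_ (Real.exp_pos _).le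
    have := mul_le_mul_of_nonneg_left hqlow hθ
    rw [hz]
    linarith
  have hD : ∫ y, g y = ∫ y : EuclideanSpace ℝ (Fin m) in Metric.ball 0 1, Real.exp (θ * quadForm M y) :=
    integral_indicator measurableSet_ball
  rw [← hD]
  have hE : V * Real.exp z ≤ 2 * ((5 / 3 : ℝ) ^ m * ∫ y, g y) := by linarith
  have hF : (3 / 5 : ℝ) ^ m * (5 / 3 : ℝ) ^ m = 1 := by
    rw [← mul_pow]; norm_num
  calc (3 / 5 : ℝ) ^ m / 2 * V * Real.exp z = (3 / 5 : ℝ) ^ m / 2 * (V * Real.exp z) := by ring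
    _ ≤ (3 / 5 : ℝ) ^ m / 2 * (2 * ((5 / 3 : ℝ) ^ m * ∫ y, g y)) :=
        mul_le_mul_of_nonneg_left hE (by positivity)
    _ = ((3 / 5 : ℝ) ^ m * (5 / 3 : ℝ) ^ m) * ∫ y, g y := by ring
    _ = _ := by rw [hF, one_mul]

/-! ### Large quadratic forms and eigenvectors of principal submatrices -/

theorem dotProduct_mulVec_eq_quadForm {n : ℕ} (M : Matrix (Fin n) (Fin n) ℝ) (y : Fin n → ℝ) :
    y ⬝ᵥ M.mulVec y = quadForm M y := by
  simp only [dotProduct, Matrix.mulVec, quadForm, Finset.mul_sum, mul_assoc]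

theorem posSemidef_of_quadForm_nonneg {n : ℕ} {M : Matrix (Fin n) (Fin n) ℝ} (hM : M.IsSymm)
    (h : ∀ y, 0 ≤ quadForm M y) : M.PosSemidef := by
  refine Matrix.PosSemidef.of_dotProduct_mulVec_nonneg ?_ fun y => ?_
  · rw [Matrix.IsHermitian, Matrix.conjTranspose_eq_transpose_of_trivial]; exact hM
  · rw [star_trivial, dotProduct_mulVec_eq_quadForm]; exact h y

theorem quadForm_smul_one_add_smul {n : ℕ} (a b : ℝ) (M : Matrix (Fin n) (Fin n) ℝ)
    (y : Fin n → ℝ) :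
    quadForm (a • 1 + b • M) y = a * ∑ i, y i ^ 2 + b * quadForm M y := by
  have : ∀ i, ∑ j, y i * (a • 1 + b • M : Matrix (Fin n) (Fin n) ℝ) i j * y j =
      a * y i ^ 2 + b * ∑ j, y i * M i j * y j := by
    intro i
    rw [Finset.mul_sum, show a * y i ^ 2 = ∑ j, if i = j then a * y i ^ 2 else 0 by simp,
      ← Finset.sum_add_distrib]
    refine Finset.sum_congr rfl fun j _ => ?_
    by_cases h : i = j
    · subst h; simp; ring
    · simp [h, Matrix.one_apply_ne h]; ring
  unfold quadForm
  rw [Finset.sum_congr rfl fun i _ => this i, Finset.sum_add_distrib, Finset.mul_sum,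
    Finset.mul_sum]

/-- The matrix `s • 1 - M` is not positive semidefinite, so it has a negative eigenvalue; its
eigenvector serves for `M`. -/
theorem exists_eigenvector_of_lt_quadForm {m : ℕ} {M : Matrix (Fin m) (Fin m) ℝ}
    (hM : M.IsSymm) {s : ℝ} {y : Fin m → ℝ} (hy : s * ∑ i, y i ^ 2 < quadForm M y) :
    ∃ (v : EuclideanSpace ℝ (Fin m)) (lam : ℝ), ‖v‖ = 1 ∧ s < lam ∧
      ∀ i, ∑ j, M i j * v j = lam * v i := by
  set K : Matrix (Fin m) (Fin m) ℝ := s • 1 + (-1 : ℝ) • M with hK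
  have hKh : K.IsHermitian := by
    rw [Matrix.IsHermitian, Matrix.conjTranspose_eq_transpose_of_trivial]
    simp [hK, Matrix.transpose_add, hM.eq]
  have hnot : ¬ K.PosSemidef := by
    intro h
    have h1 := h.dotProduct_mulVec_nonneg y
    rw [star_trivial, dotProduct_mulVec_eq_quadForm, hK, quadForm_smul_one_add_smul] at h1
    linarith
  rw [hKh.posSemidef_iff_eigenvalues_nonneg] at hnot
  obtain ⟨i, hi⟩ : ∃ i, hKh.eigenvalues i < 0 := by
    by_contra hcon
    push Not at hcon
    exact hnot hcon
  refine ⟨hKh.eigenvectorBasis i, s - hKh.eigenvalues i, hKh.eigenvectorBasis.norm_eq_one i,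
    by linarith, fun l => ?_⟩
  have h1 := congrFun (hKh.mulVec_eigenvectorBasis i) l
  have h2 : ∀ u : Fin m → ℝ, K.mulVec u = s • u + (-1 : ℝ) • M.mulVec u := fun u => by
    rw [hK, Matrix.add_mulVec, Matrix.smul_mulVec, Matrix.smul_mulVec, Matrix.one_mulVec]
  rw [h2] at h1
  simp only [Pi.add_apply, Pi.smul_apply, smul_eq_mul, Matrix.mulVec, dotProduct] at h1
  linarith

theorem sum_extend_sq {m n : ℕ} {e : Fin m → Fin n} (he : Function.Injective e) (y : Fin m → ℝ) :
    ∑ i, (Function.extend e y 0 i) ^ 2 = ∑ i, y i ^ 2 := by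
  refine (Fintype.sum_of_injective e he _ _ (fun i hi => ?_) fun i => ?_).symm
  · rw [Function.extend_apply' _ _ _ (by simpa using hi)]; simp
  · rw [he.extend_apply]

theorem quadForm_extend {m n : ℕ} {e : Fin m → Fin n} (he : Function.Injective e)
    (A : Matrix (Fin n) (Fin n) ℝ) (y : Fin m → ℝ) :
    quadForm A (Function.extend e y 0) = quadForm (A.submatrix e e) y := by
  refine (Fintype.sum_of_injective e he _ _ (fun i hi => ?_) fun i => ?_).symm
  · rw [Function.extend_apply' _ _ _ (by simpa using hi)]; simp
  · refine Fintype.sum_of_injective e he _ _ (fun j hj => ?_) fun j => ?_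
    · rw [Function.extend_apply' _ _ j (by simpa using hj)]; simp
    · rw [he.extend_apply, he.extend_apply]; rfl

/-- The matrices whose quadratic form exceeds `s` times the squared norm at some vector
supported on `T`. -/
def quadFormExceeds {n : ℕ} (T : Finset (Fin n)) (s : ℝ) : Set (Matrix (Fin n) (Fin n) ℝ) :=
  {A | ∃ y : Fin n → ℝ, (∀ i, i ∉ T → y i = 0) ∧ s * ∑ i, y i ^ 2 < quadForm A y}

theorem exists_eigenvector_submatrix {n : ℕ} {T : Finset (Fin n)} {s : ℝ}
    {A : Matrix (Fin n) (Fin n) ℝ} (hA : A.IsSymm) (h : A ∈ quadFormExceeds T s) :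
    ∃ (v : EuclideanSpace ℝ (Fin T.card)) (lam : ℝ), ‖v‖ = 1 ∧ s < lam ∧ ∀ i, ∑ j,
      (A.submatrix (T.orderEmbOfFin rfl) (T.orderEmbOfFin rfl)) i j * v j = lam * v i := by
  obtain ⟨y, hyT, hy⟩ := h
  set e := T.orderEmbOfFin rfl
  have he : Function.Injective e := e.injective
  have hext : y = Function.extend e (y ∘ e) 0 := by
    funext i
    by_cases hi : ∃ a, e a = i
    · obtain ⟨a, rfl⟩ := hi
      rw [he.extend_apply]; rfl
    · rw [Function.extend_apply' _ _ _ hi]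
      refine hyT i fun hiT => hi ?_
      have : i ∈ Set.range e := by
        rw [Finset.range_orderEmbOfFin]; exact hiT
      exact this
  rw [hext, sum_extend_sq he, quadForm_extend he] at hy
  exact exists_eigenvector_of_lt_quadForm (hA.submatrix _) hy

/-! ### Tail bounds for extreme eigenvalues -/

theorem five_thirds_pow_le (m : ℕ) : (5 / 3 : ℝ) ^ m ≤ Real.exp (3 / 5 * m) := by
  have h : (5 / 3 : ℝ) ≤ Real.exp (3 / 5) := by
    have := Real.quadratic_le_exp_of_nonneg (x := 3 / 5) (by norm_num)
    linarith
  rw [mul_comm, Real.exp_nat_mul]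
  exact pow_le_pow_left₀ (by norm_num) h m

/-- Upper tail of the largest eigenvalue of a principal submatrix of a random sign matrix. -/
theorem ncard_quadFormExceeds_le {n : ℕ} {T : Finset (Fin n)} (hT : 100 ≤ T.card) {s : ℝ}
    (hs : 3 * √(T.card : ℝ) ≤ s) :
    ((signMatrices n ∩ quadFormExceeds T s).ncard : ℝ) ≤
      2 * Real.exp (-((s - 3 * √(T.card : ℝ)) ^ 2 / 32)) * (signMatrices n).ncard := by
  classical
  set m := T.card with hm
  set e := T.orderEmbOfFin hm.symm
  have he : Function.Injective e := e.injective
  have hm' : (100 : ℝ) ≤ m := by exact_mod_cast hT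
  have hsm : √(m : ℝ) * √m = m := Real.mul_self_sqrt (by linarith)
  have h10 : 10 ≤ √(m : ℝ) := Real.le_sqrt_of_sq_le (by linarith)
  have hs0 : 0 < s := by linarith
  -- The minimiser of `θ² - (27/50) s θ`, with minimum `-(27/100)² s²`.
  set θ : ℝ := 27 / 100 * s with hθ
  have hθ0 : 0 ≤ θ := by positivity
  set V := volume.real (Metric.ball (0 : EuclideanSpace ℝ (Fin m)) 1) with hV
  have hV0 : 0 < V := by
    refine ENNReal.toReal_pos (Metric.measure_ball_pos _ _ one_pos).ne' measure_ball_lt_top.ne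
  set N : ℝ := (Fintype.card (UpperIndex n → Bool) : ℝ)
  let bad : Finset (UpperIndex n → Bool) :=
    Finset.univ.filter fun f => signMatrixOf f ∈ quadFormExceeds T s
  have hcardS : ((signMatrices n).ncard : ℝ) = N := by
    rw [← range_signMatrixOf, ← Set.image_univ,
      Set.ncard_image_of_injective _ signMatrixOf_injective, Set.ncard_univ,
      Nat.card_eq_fintype_card]
  have hcardB : ((signMatrices n ∩ quadFormExceeds T s).ncard : ℝ) = bad.card := by
    rw [← Set.ncard_coe_finset, ← Set.ncard_image_of_injective _ signMatrixOf_injective]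
    congr 2
    rw [← range_signMatrixOf]
    ext A
    simp only [bad, Set.mem_inter_iff, Set.mem_range, Set.mem_image, Finset.coe_filter,
      Finset.mem_univ, true_and, Set.mem_ofPred_eq]
    constructor
    · rintro ⟨⟨f, rfl⟩, h⟩; exact ⟨f, h, rfl⟩
    · rintro ⟨f, h, rfl⟩; exact ⟨⟨f, rfl⟩, h⟩
  let I : (UpperIndex n → Bool) → ℝ := fun f => ∫ y : EuclideanSpace ℝ (Fin m) in
    Metric.ball 0 1, Real.exp (θ * quadForm ((signMatrixOf f).submatrix e e) y)
  have hcont : ∀ f : UpperIndex n → Bool, Continuous fun y : EuclideanSpace ℝ (Fin m) =>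
      Real.exp (θ * quadForm ((signMatrixOf f).submatrix e e) y) := by
    intro f
    have := continuous_quadForm ((signMatrixOf f).submatrix e e)
    fun_prop
  have hI0 : ∀ f, 0 ≤ I f := fun f => integral_nonneg fun y => (Real.exp_pos _).le
  -- Padding `y` by zeros outside `T` lets the moment bound for the full matrix control the
  -- submatrix.
  have hupper : ∑ f, I f ≤ N * Real.exp (θ ^ 2) * V := by
    rw [← integral_finsetSum _ fun f _ => integrableOn_ball_of_continuous (hcont f)]
    have h1 : ∫ y : EuclideanSpace ℝ (Fin m) in Metric.ball 0 1, N * Real.exp (θ ^ 2) =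
        N * Real.exp (θ ^ 2) * V := by
      rw [setIntegral_const, smul_eq_mul, ← hV, mul_comm]
    rw [← h1]
    refine setIntegral_mono_on (integrableOn_ball_of_continuous
      (continuous_finsetSum _ fun f _ => hcont f))
      (integrableOn_ball_of_continuous continuous_const) measurableSet_ball fun y hy => ?_
    have hy1 : ‖y‖ < 1 := by simpa using hy
    have h2 := sum_exp_quadForm_le (n := n) θ (Function.extend e y 0)
    rw [sum_extend_sq he] at h2
    simp only [quadForm_extend he] at h2
    refine h2.trans (mul_le_mul_of_nonneg_left (Real.exp_le_exp.mpr ?_) (by positivity))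
    rw [← EuclideanSpace.real_norm_sq_eq]
    have h3 : (‖y‖ ^ 2) ^ 2 ≤ 1 :=
      pow_le_one₀ (sq_nonneg _) (pow_le_one₀ (norm_nonneg _) hy1.le)
    nlinarith [sq_nonneg θ]
  have hlower : ∀ f ∈ bad, (3 / 5 : ℝ) ^ m / 2 * V * Real.exp (θ * (27 / 50 * s)) ≤ I f := by
    intro f hf
    have hfT : signMatrixOf f ∈ quadFormExceeds T s := (Finset.mem_filter.mp hf).2
    have hfS : signMatrixOf f ∈ signMatrices n := range_signMatrixOf n ▸ ⟨f, rfl⟩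
    obtain ⟨v, lam, hv, hl, hev⟩ := exists_eigenvector_submatrix hfS.1 hfT
    have h1 := le_integral_ball_exp_quadForm (by omega) (hfS.1.submatrix e)
      (fun i => hfS.2.1 (e i)) hv (by linarith) hev hθ0
    refine le_trans ?_ h1
    rw [← hV]
    refine mul_le_mul_of_nonneg_left (Real.exp_le_exp.mpr ?_) (by positivity)
    refine mul_le_mul_of_nonneg_left ?_ hθ0
    -- Here `m ≥ 100` enters: `16/25 - 12/125 = 0.544` exceeds `27/50`.
    have h2 : 24 / 25 / √(m : ℝ) ≤ 12 / 125 := by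
      rw [div_le_iff₀ (by linarith)]; linarith
    nlinarith
  have hmain : (bad.card : ℝ) * ((3 / 5 : ℝ) ^ m / 2 * V * Real.exp (θ * (27 / 50 * s))) ≤
      N * Real.exp (θ ^ 2) * V := by
    rw [← nsmul_eq_mul]
    exact ((Finset.card_nsmul_le_sum _ _ _ hlower).trans
      (Finset.sum_le_univ_sum_of_nonneg hI0)).trans hupper
  rw [hcardS, hcardB]
  have hF : (3 / 5 : ℝ) ^ m * (5 / 3 : ℝ) ^ m = 1 := by
    rw [← mul_pow]; norm_num
  have h3 : (bad.card : ℝ) * Real.exp (θ * (27 / 50 * s)) ≤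
      2 * (5 / 3 : ℝ) ^ m * (N * Real.exp (θ ^ 2)) := by
    have h4 : (bad.card : ℝ) * ((3 / 5 : ℝ) ^ m / 2 * Real.exp (θ * (27 / 50 * s))) ≤
        N * Real.exp (θ ^ 2) := by
      refine le_of_mul_le_mul_right ?_ hV0
      linarith
    have h5 := mul_le_mul_of_nonneg_left h4 (by positivity : (0 : ℝ) ≤ 2 * (5 / 3 : ℝ) ^ m)
    refine le_trans (le_of_eq ?_) h5
    linear_combination -(bad.card : ℝ) * Real.exp (θ * (27 / 50 * s)) * hF
  have h6 : (bad.card : ℝ) ≤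
      2 * (5 / 3 : ℝ) ^ m * (N * Real.exp (θ ^ 2)) * Real.exp (-(θ * (27 / 50 * s))) := by
    rw [Real.exp_neg, ← div_eq_mul_inv, le_div_iff₀ (Real.exp_pos _)]
    exact h3
  refine h6.trans ?_
  have h7 : (5 / 3 : ℝ) ^ m * Real.exp (θ ^ 2) * Real.exp (-(θ * (27 / 50 * s))) ≤
      Real.exp (-((s - 3 * √(m : ℝ)) ^ 2 / 32)) := by
    refine (mul_le_mul_of_nonneg_right (mul_le_mul_of_nonneg_right (five_thirds_pow_le m)
      (Real.exp_pos _).le) (Real.exp_pos _).le).trans ?_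
    rw [← Real.exp_add, ← Real.exp_add, Real.exp_le_exp, hθ]
    -- Put `u = s - 3√m ≥ 0` and expand `s²`: it suffices that `0.0729 · 9 ≥ 3/5` (terms in `m`) and
    -- `0.0729 ≥ 1/32` (terms in `u²`); the cross term has the right sign.
    nlinarith [mul_nonneg (by linarith : 0 ≤ √(m : ℝ)) (by linarith : 0 ≤ s - 3 * √(m : ℝ)),
      sq_nonneg (s - 3 * √(m : ℝ))]
  have hN : 0 ≤ N := by positivity
  have := mul_le_mul_of_nonneg_left h7 (by positivity : 0 ≤ 2 * N)
  linarith

theorem neg_mem_signMatrices {n : ℕ} {A : Matrix (Fin n) (Fin n) ℝ} (hA : A ∈ signMatrices n) :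
    -A ∈ signMatrices n := by
  refine ⟨?_, fun i => by simp [hA.2.1 i], fun i j hij => ?_⟩
  · rw [Matrix.IsSymm, Matrix.transpose_neg, hA.1.eq]
  · rcases hA.2.2 i j hij with h | h <;> simp [h]

/-- Lower tail of the smallest eigenvalue of a principal submatrix of a random sign matrix. -/
theorem ncard_neg_quadFormExceeds_le {n : ℕ} {T : Finset (Fin n)} (hT : 100 ≤ T.card) {s : ℝ}
    (hs : 3 * √(T.card : ℝ) ≤ s) :
    ((signMatrices n ∩ {A | -A ∈ quadFormExceeds T s}).ncard : ℝ) ≤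
      2 * Real.exp (-((s - 3 * √(T.card : ℝ)) ^ 2 / 32)) * (signMatrices n).ncard := by
  refine le_trans ?_ (ncard_quadFormExceeds_le hT hs)
  -- The uniform distribution on sign matrices is invariant under `A ↦ -A`.
  rw [← Set.ncard_image_of_injective _ (neg_injective (G := Matrix (Fin n) (Fin n) ℝ))]
  refine Nat.cast_le.mpr (Set.ncard_le_ncard ?_ ((finite_signMatrices n).inter_of_left _))
  rintro _ ⟨A, ⟨hA, hA'⟩, rfl⟩
  exact ⟨neg_mem_signMatrices hA, hA'⟩

/-! ### From quadratic forms to the RIP -/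

theorem choleskyOrZero_spec {n : ℕ} {B : Matrix (Fin n) (Fin n) ℝ} (hB : B.PosSemidef) :
    IsCholeskyFactor B (choleskyOrZero B) := by
  rw [choleskyOrZero, dif_pos hB]
  exact (exists_isCholeskyFactor hB).choose_spec

theorem sum_mulVec_sq {n : ℕ} (C : Matrix (Fin n) (Fin n) ℝ) (y : Fin n → ℝ) :
    ∑ i, (∑ j, C i j * y j) ^ 2 = quadForm (C.transpose * C) y := by
  rw [← dotProduct_mulVec_eq_quadForm, ← Matrix.mulVec_mulVec, Matrix.dotProduct_mulVec,
    Matrix.vecMul_transpose]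
  simp only [dotProduct, Matrix.mulVec, sq]

theorem norm_sq_eq_re_add_im {n : ℕ} (x : EuclideanSpace ℂ (Fin n)) :
    ‖x‖ ^ 2 = ∑ i, (x i).re ^ 2 + ∑ i, (x i).im ^ 2 := by
  rw [EuclideanSpace.norm_sq_eq, ← Finset.sum_add_distrib]
  refine Finset.sum_congr rfl fun i _ => ?_
  rw [← Complex.normSq_eq_norm_sq, Complex.normSq_apply]
  ring

theorem norm_toEuclideanLin_map_sq {n : ℕ} (C : Matrix (Fin n) (Fin n) ℝ)
    (x : EuclideanSpace ℂ (Fin n)) :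
    ‖Matrix.toEuclideanLin (C.map ((↑) : ℝ → ℂ)) x‖ ^ 2 =
      quadForm (C.transpose * C) (fun i => (x i).re) +
        quadForm (C.transpose * C) (fun i => (x i).im) := by
  rw [norm_sq_eq_re_add_im, ← sum_mulVec_sq, ← sum_mulVec_sq]
  simp [Matrix.toLpLin_apply, Matrix.mulVec, dotProduct]

/-- A shifted symmetric matrix whose quadratic form is bounded on sparse vectors, and bounded
below on all vectors, has a Cholesky factor with the restricted isometry property. -/
theorem satisfiesRIP_of_quadForm_le {n k : ℕ} (hk : k ≤ n) (hn : 0 < n) {c δ : ℝ} (hc : 0 < c)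
    {A : Matrix (Fin n) (Fin n) ℝ} (hA : A.IsSymm)
    (hlow : -A ∉ quadFormExceeds Finset.univ (√(n : ℝ) / c))
    (hT : ∀ T ∈ Finset.powersetCard k (Finset.univ : Finset (Fin n)),
      A ∉ quadFormExceeds T (δ * √(n : ℝ) / c) ∧ -A ∉ quadFormExceeds T (δ * √(n : ℝ) / c)) :
    SatisfiesRIP k δ ((choleskyOrZero (shiftedMatrix c A)).map ((↑) : ℝ → ℂ)) := by
  have hsq : 0 < √(n : ℝ) := Real.sqrt_pos.mpr (by exact_mod_cast hn)
  have hr : 0 < c / √(n : ℝ) := by positivity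
  have hq : ∀ y, quadForm (shiftedMatrix c A) y =
      ∑ i, y i ^ 2 + c / √(n : ℝ) * quadForm A y := by
    intro y
    have := quadForm_smul_one_add_smul 1 (c / √(n : ℝ)) A y
    rwa [one_smul, one_mul] at this
  have hneg : ∀ y, quadForm (-A) y = -quadForm A y := by
    intro y
    simp [quadForm]
  have hpsd : (shiftedMatrix c A).PosSemidef := by
    refine posSemidef_of_quadForm_nonneg ?_ fun y => ?_
    · rw [Matrix.IsSymm, shiftedMatrix, Matrix.transpose_add, Matrix.transpose_smul, hA.eq,
        Matrix.transpose_one]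
    · have h1 : ¬ √(n : ℝ) / c * ∑ i, y i ^ 2 < quadForm (-A) y :=
        fun h => hlow ⟨y, fun i hi => absurd (Finset.mem_univ i) hi, h⟩
      rw [not_lt, hneg] at h1
      have h2 := mul_le_mul_of_nonneg_left h1 hr.le
      have h3 : c / √(n : ℝ) * (√(n : ℝ) / c * ∑ i, y i ^ 2) = ∑ i, y i ^ 2 := by
        field_simp
      rw [hq]
      linarith
  have hspec := (choleskyOrZero_spec hpsd).2.2
  intro x hx
  classical
  set S : Finset (Fin n) := Finset.univ.filter fun i => x i ≠ 0
  have hS : S.card ≤ k := by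
    rw [← Set.ncard_coe_finset]
    simpa [S, IsSparse] using hx
  -- The support is enlarged to exactly `k` elements, so the union bound only runs over `k`-sets.
  obtain ⟨T, hST, hTk⟩ := Finset.exists_superset_card_eq hS (by simpa using hk)
  obtain ⟨hT1, hT2⟩ := hT T (Finset.mem_powersetCard.mpr ⟨Finset.subset_univ _, hTk⟩)
  have hx0 : ∀ i, i ∉ T → x i = 0 := by
    intro i hi
    by_contra h
    exact hi (hST (Finset.mem_filter.mpr ⟨Finset.mem_univ i, h⟩))
  have hbound : ∀ y : Fin n → ℝ, (∀ i, i ∉ T → y i = 0) →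
      (1 - δ) * ∑ i, y i ^ 2 ≤ quadForm (shiftedMatrix c A) y ∧
        quadForm (shiftedMatrix c A) y ≤ (1 + δ) * ∑ i, y i ^ 2 := by
    intro y hy
    have h1 : ¬ δ * √(n : ℝ) / c * ∑ i, y i ^ 2 < quadForm A y := fun h => hT1 ⟨y, hy, h⟩
    have h2 : ¬ δ * √(n : ℝ) / c * ∑ i, y i ^ 2 < quadForm (-A) y := fun h => hT2 ⟨y, hy, h⟩
    rw [not_lt] at h1 h2
    rw [hneg] at h2
    have h3 := mul_le_mul_of_nonneg_left h1 hr.le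
    have h4 := mul_le_mul_of_nonneg_left h2 hr.le
    have h5 : c / √(n : ℝ) * (δ * √(n : ℝ) / c * ∑ i, y i ^ 2) = δ * ∑ i, y i ^ 2 := by
      field_simp
    rw [hq]
    constructor <;> linarith
  -- The matrix is real, so a complex vector splits into real and imaginary parts, both supported on
  -- `T`.
  obtain ⟨r1, r2⟩ := hbound (fun i => (x i).re) fun i hi => by simp [hx0 i hi]
  obtain ⟨i1, i2⟩ := hbound (fun i => (x i).im) fun i hi => by simp [hx0 i hi]
  rw [norm_toEuclideanLin_map_sq, hspec, norm_sq_eq_re_add_im]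
  constructor <;> linarith

/-! ### Union bound over supports -/

/-- This is `n^k / k! = (n/k)^k · k^k / k!`, where `k^k / k!` is one term of the series of `exp k`.
-/
theorem choose_le_exp_mul_log {n k : ℕ} (hk : 0 < k) (hkn : k ≤ n) :
    (n.choose k : ℝ) ≤ Real.exp (k * Real.log (n * Real.exp 1 / k)) := by
  have hk' : (0 : ℝ) < k := by exact_mod_cast hk
  have hn' : (0 : ℝ) < n := by exact_mod_cast hk.trans_le hkn
  have h1 : Real.exp (k * Real.log (n * Real.exp 1 / k)) = (n * Real.exp 1 / k) ^ k := by
    rw [Real.exp_nat_mul, Real.exp_log (by positivity)]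
  have h2 := Real.pow_div_factorial_le_exp (k : ℝ) hk'.le k
  have h3 : (n : ℝ) ^ k / k.factorial = (n / k : ℝ) ^ k * ((k : ℝ) ^ k / k.factorial) := by
    rw [div_pow]
    field_simp
  rw [h1]
  calc (n.choose k : ℝ) ≤ (n : ℝ) ^ k / k.factorial := Nat.choose_le_pow_div k n
    _ ≤ (n / k : ℝ) ^ k * Real.exp k := by
        rw [h3]; exact mul_le_mul_of_nonneg_left h2 (by positivity)
    _ = _ := by
        rw [← Real.exp_one_pow, ← mul_pow]
        congr 1
        ring

theorem mainTheorem7 :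
    ∃ k₀ : ℕ, ∀ (n k : ℕ) (c δ : ℝ), k₀ ≤ k → k ≤ n → 0 < c →
      3 * c < min 1 (δ * √(n : ℝ) / √(k : ℝ)) →
      1 - 4 * Real.exp ((k : ℝ) * Real.log ((n : ℝ) * Real.exp 1 / (k : ℝ)) -
              (δ * √(n : ℝ) / c - 3 * √(k : ℝ)) ^ 2 / 32)
          - 4 * Real.exp (-((1 / c - 3) ^ 2 * (n : ℝ) / 32)) ≤
        uniformProb (signMatrices n)
          {A | SatisfiesRIP k δ
            ((choleskyOrZero (shiftedMatrix c A)).map ((↑) : ℝ → ℂ))} := by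
  refine ⟨100, fun n k c δ hk hkn hc hmin => ?_⟩
  obtain ⟨hc1, hc2⟩ := lt_min_iff.mp hmin
  have hk' : (0 : ℝ) < √(k : ℝ) := Real.sqrt_pos.mpr (by exact_mod_cast (by omega : 0 < k))
  have hn' : (0 : ℝ) < √(n : ℝ) := Real.sqrt_pos.mpr (by exact_mod_cast (by omega : 0 < n))
  set s := δ * √(n : ℝ) / c with hs
  have hs3 : 3 * √(k : ℝ) ≤ s := by
    rw [lt_div_iff₀ hk'] at hc2
    rw [hs, le_div_iff₀ hc]
    linarith
  have ht3 : 3 * √(n : ℝ) ≤ √(n : ℝ) / c := by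
    rw [le_div_iff₀ hc]
    nlinarith
  set G := {A : Matrix (Fin n) (Fin n) ℝ | SatisfiesRIP k δ
    ((choleskyOrZero (shiftedMatrix c A)).map ((↑) : ℝ → ℂ))} with hG
  set S := signMatrices n with hS
  have hfin : S.Finite := finite_signMatrices n
  set P := Finset.powersetCard k (Finset.univ : Finset (Fin n)) with hP
  let b : Finset (Fin n) → Set (Matrix (Fin n) (Fin n) ℝ) := fun T =>
    (S ∩ quadFormExceeds T s) ∪ (S ∩ {A | -A ∈ quadFormExceeds T s})
  let d : Set (Matrix (Fin n) (Fin n) ℝ) :=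
    S ∩ {A | -A ∈ quadFormExceeds Finset.univ (√(n : ℝ) / c)}
  -- Every sign matrix is good, or violates the two-sided bound on some `k`-set, or violates the
  -- lower bound needed for semidefiniteness.
  have hcover : S ⊆ (S ∩ G) ∪ ((⋃ T ∈ P, b T) ∪ d) := by
    intro A hA
    by_contra hcon
    simp only [Set.mem_union, not_or, Set.mem_iUnion, not_exists, b, d, Set.mem_inter_iff,
      not_and] at hcon
    obtain ⟨hG', hb, hd⟩ := hcon
    exact hG' hA (satisfiesRIP_of_quadForm_le hkn (by omega) hc hA.1 (hd hA)
      fun T hT => ⟨(hb T hT).1 hA, (hb T hT).2 hA⟩)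
  have hfincover : ((S ∩ G) ∪ ((⋃ T ∈ P, b T) ∪ d)).Finite := by
    refine hfin.subset ?_
    simp only [b, d, Set.union_subset_iff, Set.iUnion_subset_iff]
    exact ⟨Set.inter_subset_left, fun T _ => ⟨Set.inter_subset_left, Set.inter_subset_left⟩,
      Set.inter_subset_left⟩
  have hcount : S.ncard ≤ (S ∩ G).ncard + (∑ T ∈ P, (b T).ncard + d.ncard) :=
    (Set.ncard_le_ncard hcover hfincover).trans ((Set.ncard_union_le _ _).trans
      (Nat.add_le_add_left ((Set.ncard_union_le _ _).trans
        (Nat.add_le_add_right (P.set_ncard_biUnion_le b) _)) _))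
  have hcount' : (S.ncard : ℝ) ≤ (S ∩ G).ncard + (∑ T ∈ P, ((b T).ncard : ℝ) + d.ncard) := by
    exact_mod_cast hcount
  have hNpos : (0 : ℝ) < S.ncard := by
    have hne : S.Nonempty := by
      rw [hS, ← range_signMatrixOf]
      exact Set.range_nonempty _
    exact_mod_cast (Set.ncard_pos hfin).mpr hne
  have hb : ∀ T ∈ P, ((b T).ncard : ℝ) ≤
      4 * Real.exp (-((s - 3 * √(k : ℝ)) ^ 2 / 32)) * S.ncard := by
    intro T hT
    have hTk : T.card = k := (Finset.mem_powersetCard.mp hT).2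
    have h1 := ncard_quadFormExceeds_le (T := T) (s := s) (by omega) (by rwa [hTk])
    have h2 := ncard_neg_quadFormExceeds_le (T := T) (s := s) (by omega) (by rwa [hTk])
    rw [hTk] at h1 h2
    have h3 : ((b T).ncard : ℝ) ≤ (S ∩ quadFormExceeds T s).ncard +
        (S ∩ {A | -A ∈ quadFormExceeds T s}).ncard := by
      exact_mod_cast Set.ncard_union_le _ _
    linarith
  -- Only one tail is needed here, so the tail bound gives the constant 2, relaxed to 4.
  have hd : (d.ncard : ℝ) ≤ 4 * Real.exp (-((1 / c - 3) ^ 2 * (n : ℝ) / 32)) * S.ncard := by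
    have hcard : (Finset.univ : Finset (Fin n)).card = n := by simp
    have h1 := ncard_neg_quadFormExceeds_le (T := (Finset.univ : Finset (Fin n)))
      (s := √(n : ℝ) / c) (by omega) (by rwa [hcard])
    rw [hcard] at h1
    have h2 : (√(n : ℝ) / c - 3 * √(n : ℝ)) ^ 2 = (1 / c - 3) ^ 2 * n := by
      have : √(n : ℝ) ^ 2 = n := Real.sq_sqrt (Nat.cast_nonneg n)
      linear_combination (1 / c - 3) ^ 2 * this
    rw [h2] at h1
    have h3 : 0 ≤ Real.exp (-((1 / c - 3) ^ 2 * (n : ℝ) / 32)) * (S.ncard : ℝ) := by positivity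
    linarith
  have hsum : ∑ T ∈ P, ((b T).ncard : ℝ) ≤
      4 * Real.exp ((k : ℝ) * Real.log ((n : ℝ) * Real.exp 1 / (k : ℝ)) -
        (s - 3 * √(k : ℝ)) ^ 2 / 32) * S.ncard := by
    refine (Finset.sum_le_card_nsmul _ _ _ hb).trans ?_
    rw [hP, Finset.card_powersetCard, Finset.card_univ, Fintype.card_fin, nsmul_eq_mul,
      sub_eq_add_neg _ (_ / _), Real.exp_add]
    have h1 := mul_le_mul_of_nonneg_right (choose_le_exp_mul_log (by omega) hkn)
      (by positivity : 0 ≤ 4 * Real.exp (-((s - 3 * √(k : ℝ)) ^ 2 / 32)) * (S.ncard : ℝ))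
    linarith
  rw [uniformProb, le_div_iff₀ hNpos]
  linarith
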